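/- Let $p$ be a prime and let $E$ be an extraspecial $p$-group, i.e. a finite $p$-group whose derived subgroup $E'$ and center $Z(E)$ coincide and have order $p$. Let $\rho$ be a faithful irreducible unitary representation of $E$ of degree $|E:Z(E)|^{1/2}$ on a finite-dimensional complex inner product space $H$, with character $\phi$. Let $N$ be a normal subgroup of $E$ with $N\neq 1$, and let $\chi$ be an irreducible complex character of $N$ such that $(\chi,\phi|_N)_N=|N|^{-1}\sum_{n\in N}\chi(n)\phi(n^{-1})>0$. Let $C\subseteq H$ be the Clifford code with data $(E,\rho,N,\chi)$, i.e. the image of the projector $$P=\frac{\chi(1)}{|N|}\sum_{n\in N}\chi(n^{-1})\rho(n).$$ Then $C$ is an operator quantum error-correcting code $C=A\otimes B$; that is, there are finite-dimensional complex inner product spaces $A$, $B$ and a unitary isomorphism $A\otimes B\cong C$ (so that $H=(A\otimes B)\oplus C^\perp$), such that i) $\dim A=|Z(E)\cap N|\,|E:Z(E)|^{1/2}\,|N:Z(N)|^{1/2}/|N|$, ii) $\dim B=|N:Z(N)|^{1/2}$, and an error $e\in E$ is detectable by the subsystem $A$ if and only if $e\in E-(NC_E(N)-N)$, where $C_E(N)$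 is the centralizer of $N$ in $E$. Here $e$ is called detectable by $A$ if the compression of $\rho(e)$ to $C$ (that is, $\rho(e)$ restricted to $C$ and followed by the orthogonal projection of $H$ onto $C$) has the form $1_A\otimes M$ under the identification $C=A\otimes B$, for some linear operator $M$ on $B$. -/

import Mathlib

open scoped TensorProduct Pointwise

noncomputable section

/-- A finite group `E` of `p`-power order, `p` a prime, is extraspecial if its derived subgroup
and its centre coincide and have order `p`. -/
structure IsExtraspecial (p : ℕ) (E : Type*) [Group E] : Prop where
  prime : p.Prime
  finite : Finite E
  isPGroup : IsPGroup p E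
  commutator_eq_center : commutator E = Subgroup.center E
  card_center : Nat.card (Subgroup.center E) = p

/-- `ρ` makes `E` an abstract error group: it is a faithful irreducible unitary representation of
degree `|E : Z(E)| ^ (1/2)`. -/
structure IsErrorRepresentation {E H : Type*} [Group E] [NormedAddCommGroup H]
    [InnerProductSpace ℂ H] (ρ : Representation ℂ E H) : Prop where
  unitary : ∀ (g : E) (x y : H), inner ℂ (ρ g x) (ρ g y) = inner ℂ x y
  irreducible : ρ.IsIrreducible
  faithful : Function.Injective ρ
  degree : (Module.finrank ℂ H : ℝ) = √((Subgroup.center E).index : ℝ)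

/-- `χ` is the character of an irreducible finite-dimensional complex representation of `G`. -/
def IsIrreducibleCharacter {G : Type*} [Group G] (χ : G → ℂ) : Prop :=
  ∃ (d : ℕ) (σ : Representation ℂ G (Fin d → ℂ)), σ.IsIrreducible ∧ σ.character = χ

/-- The scalar product `(χ, ψ)_G = |G|⁻¹ ∑ χ(g) ψ(g⁻¹)` of class functions on a finite group. -/
def characterScalarProduct {G : Type*} [Group G] (χ ψ : G → ℂ) : ℂ :=
  (Nat.card G : ℂ)⁻¹ * ∑ᶠ g : G, χ g * ψ g⁻¹

open scoped ComplexOrder in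
/-- The data `(E, ρ, N, χ)` of a Clifford code: an abstract error group `E` with representation `ρ`
(and character `φ`), a normal subgroup `N` of `E`, and `χ ∈ Irr(N)` with `(χ, φ_N)_N > 0`. -/
structure IsCliffordData {E H : Type*} [Group E] [NormedAddCommGroup H]
    [InnerProductSpace ℂ H] (ρ : Representation ℂ E H) (N : Subgroup E) (χ : N → ℂ) : Prop where
  errorRepresentation : IsErrorRepresentation ρ
  normal : N.Normal
  irreducibleCharacter : IsIrreducibleCharacter χ
  pos : 0 < characterScalarProduct χ (fun n : N => ρ.character (n : E))

/-- The operator `P = χ(1) / |N| ∑ χ(n⁻¹) ρ(n)`, the sum being over `n ∈ N`. -/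
def cliffordProjector {E H : Type*} [Group E] [NormedAddCommGroup H]
    [InnerProductSpace ℂ H] (ρ : Representation ℂ E H) (N : Subgroup E) (χ : N → ℂ) :
    H →ₗ[ℂ] H :=
  (χ 1 / (Nat.card N : ℂ)) • ∑ᶠ n : N, χ n⁻¹ • ρ (n : E)

/-- The Clifford code with data `(E, ρ, N, χ)`: the image of the projector `P`. -/
def cliffordCode {E H : Type*} [Group E] [NormedAddCommGroup H]
    [InnerProductSpace ℂ H] (ρ : Representation ℂ E H) (N : Subgroup E) (χ : N → ℂ) :
    Submodule ℂ H :=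
  LinearMap.range (cliffordProjector ρ N χ)

/-- Let `C ≤ H` be an operator quantum error-correcting code, that is, a subspace together with a
unitary identification `U : A ⊗ B ≃ C`, so that `H = (A ⊗ B) ⊕ Cᗮ`. An error `T` is detectable by
the subsystem `A` if its compression to `C` is of the form `1_A ⊗ M` for some operator `M` on the
co-subsystem `B`. -/
def IsDetectableBySubsystem {H A B : Type*}
    [NormedAddCommGroup H] [InnerProductSpace ℂ H]
    [NormedAddCommGroup A] [InnerProductSpace ℂ A]
    [NormedAddCommGroup B] [InnerProductSpace ℂ B]
    (C : Submodule ℂ H) [C.HasOrthogonalProjection]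
    (U : (A ⊗[ℂ] B) ≃ₗᵢ[ℂ] C) (T : H →ₗ[ℂ] H) : Prop :=
  ∃ M : B →ₗ[ℂ] B, ∀ x : A ⊗[ℂ] B,
    C.orthogonalProjectionOnto (T (U x : H)) = U (LinearMap.lTensor A M x)

end

/-! Structure of `C`. By Schur orthogonality, the coefficients of a unitary matrix model `s` of `χ`
give operators `E_ij` on `H` that multiply like matrix units, satisfy `E_ij* = E_ji`, and have `∑
E_ii = P`. Hence `C = A ⊗ B` with `A` the range of one `E_oo`, and `N` acts on it as `1 ⊗ s`
(`exists_tensor_equiv`).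

Dimensions. `E` has class two, `Z(E) ≤ N` (`IsExtraspecial.center_le`), and `Z(E)` acts through a
faithful linear character `ω`. Conjugating an element multiplies its character value by `ω` of a
commutator, so `φ` vanishes off `Z(E)` and `χ` off `Z(N)`. The norm of `χ` then gives `dim B`, and
the trace of `P` gives `dim A`.

Detectability. Elements of `N` act as `1 ⊗ s`. If `e ∉ N C_E(N)`, a counting argument
(`mem_mul_centralizer_of_commute`) finds `z ∈ Z(N)` not commuting with `e`; then `z` has different
eigenvalues on `C` and `eC`, which are therefore orthogonal. If `e = nk` is detectable with `k ∈
C_E(N)`, Schur's lemma makes `k` scalar on `C`, and `tr(ρ(k)P) ≠ 0` forces `k ∈ N`. -/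

open scoped commutatorElement

/-! ### Schur's lemma, unitary models and orthogonality of coefficients. -/

/-- A matrix representation by unitary matrices whose commutant consists of the scalars. -/
structure IsUnitaryIrreducible {G : Type*} [Group G] {d : ℕ}
    (s : G →* Matrix (Fin d) (Fin d) ℂ) : Prop where
  inv_eq : ∀ g, s g⁻¹ = (s g).conjTranspose
  scalar_of_commute : ∀ X, (∀ g, X * s g = s g * X) → ∃ c : ℂ, X = c • 1

lemma Representation.IsIrreducible.exists_eq_smul_id {G V : Type*} [Group G] [AddCommGroup V]
    [Module ℂ V] [FiniteDimensional ℂ V] {σ : Representation ℂ G V} (hσ : σ.IsIrreducible)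
    (f : V →ₗ[ℂ] V) (hf : ∀ g, f ∘ₗ σ g = σ g ∘ₗ f) :
    ∃ c : ℂ, f = c • LinearMap.id := by
  obtain ⟨c, hc⟩ := (IsIrreducible.algebraMap_intertwiningMap_bijective_of_isAlgClosed
    (ρ := σ)).2 ⟨f, hf⟩
  refine ⟨c, LinearMap.ext fun v => ?_⟩
  have := congrArg (fun F : IntertwiningMap σ σ => F v) hc
  simpa using this.symm

open scoped ComplexOrder MatrixOrder in
lemma Matrix.PosDef.exists_eq_conjTranspose_mul_self {d : ℕ} {S : Matrix (Fin d) (Fin d) ℂ}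
    (hS : S.PosDef) : ∃ R : Matrix (Fin d) (Fin d) ℂ, IsUnit R ∧ S = R.conjTranspose * R := by
  obtain ⟨R, hR, h⟩ := CStarAlgebra.isStrictlyPositive_iff_eq_star_mul_self.mp
    hS.isStrictlyPositive
  exact ⟨R, hR, h⟩

-- Weyl's unitary trick: the averaged form `S = ∑ (t g)ᴴ * t g` is invariant, and writing `S = Rᴴ *
-- R`, conjugation by `R` makes `t` unitary.
open scoped ComplexOrder in
open Matrix in
lemma exists_isUnitaryIrreducible {G : Type*} [Group G] [Fintype G] {d : ℕ}
    (σ : Representation ℂ G (Fin d → ℂ)) (hσ : σ.IsIrreducible) :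
    ∃ s : G →* Matrix (Fin d) (Fin d) ℂ, IsUnitaryIrreducible s ∧
      ∀ g, (s g).trace = σ.character g := by
  classical
  let t : G →* Matrix (Fin d) (Fin d) ℂ :=
    (LinearMap.toMatrixAlgEquiv' : _ ≃ₐ[ℂ] Matrix (Fin d) (Fin d) ℂ).toAlgHom.toMonoidHom.comp σ
  have ht : ∀ g, t g = LinearMap.toMatrix' (σ g) := fun g => rfl
  let S : Matrix (Fin d) (Fin d) ℂ := ∑ g, (t g)ᴴ * t g
  have hS : S.PosDef := by
    have h1 : ∀ g : G, ((t g)ᴴ * t g).PosSemidef := fun g => posSemidef_conjTranspose_mul_self _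
    -- The term at `1` is the identity matrix; it alone makes the semidefinite sum definite.
    have h2 : S = (t 1)ᴴ * t 1 + ∑ g ∈ Finset.univ.erase 1, (t g)ᴴ * t g :=
      (Finset.add_sum_erase _ _ (Finset.mem_univ 1)).symm
    rw [h2]
    refine PosDef.add_posSemidef ?_ (posSemidef_sum _ fun g _ => h1 g)
    simpa using PosDef.one
  obtain ⟨R, hR, hSR⟩ := hS.exists_eq_conjTranspose_mul_self
  have hRd : IsUnit R.det := (isUnit_iff_isUnit_det R).mp hR
  have hR1 : R⁻¹ * R = 1 := nonsing_inv_mul R hRd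
  have hR2 : R * R⁻¹ = 1 := mul_nonsing_inv R hRd
  have hSt : ∀ g, (t g)ᴴ * S * t g = S := by
    intro g
    simp only [S, Finset.mul_sum, Finset.sum_mul]
    refine Fintype.sum_equiv (Equiv.mulRight g) _ _ fun h => ?_
    simp [conjTranspose_mul, mul_assoc]
  let s : G →* Matrix (Fin d) (Fin d) ℂ :=
    { toFun := fun g => R * t g * R⁻¹
      map_one' := by simp [hR2]
      map_mul' := fun g h => by
        rw [map_mul]
        calc R * (t g * t h) * R⁻¹ = R * t g * 1 * t h * R⁻¹ := by simp only [mul_one, mul_assoc]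
          _ = _ := by rw [← hR1]; simp only [mul_assoc] }
  have hs : ∀ g, s g = R * t g * R⁻¹ := fun g => rfl
  refine ⟨s, ⟨fun g => ?_, fun X hX => ?_⟩, fun g => ?_⟩
  · have h1 : (s g)ᴴ * s g = 1 := by
      have h2 : (s g)ᴴ * s g = (R⁻¹)ᴴ * ((t g)ᴴ * S * t g) * R⁻¹ := by
        rw [hs, hSR]; simp only [conjTranspose_mul, mul_assoc]
      rw [h2, hSt, hSR]
      calc (R⁻¹)ᴴ * (Rᴴ * R) * R⁻¹ = (R * R⁻¹)ᴴ * (R * R⁻¹) := by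
            simp only [conjTranspose_mul, mul_assoc]
        _ = 1 := by simp [hR2]
    have h3 : s g * s g⁻¹ = 1 := by rw [← map_mul]; simp
    calc s g⁻¹ = (s g)ᴴ * s g * s g⁻¹ := by rw [h1, one_mul]
      _ = (s g)ᴴ := by rw [mul_assoc, h3, mul_one]
  · obtain ⟨c, hc⟩ := hσ.exists_eq_smul_id (Matrix.toLin' (R⁻¹ * X * R)) (fun g => by
      have h1 : R⁻¹ * X * R * t g = t g * (R⁻¹ * X * R) := by
        calc R⁻¹ * X * R * t g = R⁻¹ * X * R * t g * (R⁻¹ * R) := by rw [hR1, mul_one]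
          _ = R⁻¹ * (X * s g) * R := by rw [hs]; simp only [mul_assoc]
          _ = (R⁻¹ * R) * t g * (R⁻¹ * X * R) := by rw [hX, hs]; simp only [mul_assoc]
          _ = _ := by rw [hR1, one_mul]
      have h2 := congrArg Matrix.toLin' h1
      rw [Matrix.toLin'_mul, Matrix.toLin'_mul (t g), ht, Matrix.toLin'_toMatrix'] at h2
      exact h2)
    refine ⟨c, ?_⟩
    have h1 : R⁻¹ * X * R = c • 1 := by
      apply Matrix.toLin'.injective
      rw [hc]; simp
    calc X = (R * R⁻¹) * X * (R * R⁻¹) := by rw [hR2]; simp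
      _ = R * (R⁻¹ * X * R) * R⁻¹ := by simp only [mul_assoc]
      _ = c • 1 := by rw [h1]; simp [hR2]
  · rw [hs, trace_mul_comm, ← mul_assoc, hR1, one_mul, ht, Representation.character,
      LinearMap.trace_eq_matrix_trace ℂ (Pi.basisFun ℂ (Fin d)), LinearMap.toMatrix_eq_toMatrix']

namespace IsUnitaryIrreducible

variable {G : Type*} [Group G] {d : ℕ} {s : G →* Matrix (Fin d) (Fin d) ℂ}

lemma apply_inv (hs : IsUnitaryIrreducible s) (g : G) (i j : Fin d) :
    s g⁻¹ i j = star (s g j i) := by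
  rw [hs.inv_eq, Matrix.conjTranspose_apply]

/-- Averaging a matrix over the group gives a multiple of its trace. -/
lemma sum_mul_mul [Fintype G] (hs : IsUnitaryIrreducible s) (X : Matrix (Fin d) (Fin d) ℂ) :
    (d : ℂ) • ∑ g, s g * X * s g⁻¹ = ((Fintype.card G : ℂ) * X.trace) • 1 := by
  obtain ⟨c, hc⟩ := hs.scalar_of_commute (∑ g, s g * X * s g⁻¹) (fun h => by
    rw [Finset.sum_mul, Finset.mul_sum]
    refine Fintype.sum_equiv (Equiv.mulLeft h⁻¹) _ _ fun g => ?_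
    calc s g * X * s g⁻¹ * s h = s g * X * s (g⁻¹ * h) := by rw [map_mul]; simp only [mul_assoc]
      _ = s (h * (h⁻¹ * g)) * X * s (h⁻¹ * g)⁻¹ := by simp
      _ = _ := by rw [map_mul]; simp only [mul_assoc, Equiv.coe_mulLeft])
  have ht : (Fintype.card G : ℂ) * X.trace = c * d := by
    have h1 := congrArg Matrix.trace hc
    have h2 : ∀ g : G, (s g * X * s g⁻¹).trace = X.trace := fun g => by
      rw [Matrix.trace_mul_comm, ← mul_assoc, ← map_mul]; simp
    rw [Matrix.trace_sum] at h1
    simpa [h2] using h1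
  rw [hc, ht, smul_smul, mul_comm]

/-- Entry `(i, k)` of the averaging identity for the elementary matrix at `(j, l)`. -/
lemma sum_apply_mul_star_apply [Fintype G] (hs : IsUnitaryIrreducible s) (i j k l : Fin d) :
    (d : ℂ) * ∑ g, s g i j * star (s g k l) =
      if i = k ∧ j = l then (Fintype.card G : ℂ) else 0 := by
  have h := congrFun (congrFun (hs.sum_mul_mul (Matrix.single j l 1)) i) k
  have h1 : ∀ g : G, (s g * Matrix.single j l 1 * s g⁻¹ : Matrix (Fin d) (Fin d) ℂ) i k = s g i j * star (s g k l) := fun g => by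
    rw [← hs.apply_inv, Matrix.mul_assoc, Matrix.mul_apply, Finset.sum_eq_single j]
    · simp
    · intro b _ hb
      simp [Matrix.single_mul_apply_of_ne, hb]
    · simp
  simp only [Matrix.smul_apply, Matrix.sum_apply, h1, smul_eq_mul] at h
  rw [h]
  by_cases hik : i = k <;> by_cases hjl : j = l <;>
    simp [hik, hjl, Matrix.one_apply, Matrix.trace_single_eq_of_ne]

end IsUnitaryIrreducible

/-! ### Matrix units in the group algebra and the isotypic component. -/

/-- The operators `d / |G| ∑ conj (s g i j) τ g` attached to the matrix coefficients of a
`d`-dimensional matrix representation `s`. -/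
noncomputable def matrixUnit {G H : Type*} [Group G] [Fintype G] [AddCommGroup H] [Module ℂ H]
    {d : ℕ} (s : G →* Matrix (Fin d) (Fin d) ℂ) (τ : Representation ℂ G H) (i j : Fin d) :
    H →ₗ[ℂ] H :=
  ((d : ℂ) / Fintype.card G) • ∑ g, star (s g i j) • τ g

namespace IsUnitaryIrreducible

section Algebra

variable {G H : Type*} [Group G] [Fintype G] [AddCommGroup H] [Module ℂ H]
  {d : ℕ} {s : G →* Matrix (Fin d) (Fin d) ℂ}

lemma apply_matrixUnit (hs : IsUnitaryIrreducible s) (τ : Representation ℂ G H) (g : G)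
    (k l : Fin d) (x : H) :
    τ g (matrixUnit s τ k l x) = ∑ r, s g r k • matrixUnit s τ r l x := by
  simp only [matrixUnit, LinearMap.smul_apply, map_smul, LinearMap.sum_apply, map_sum]
  simp only [smul_comm _ ((d : ℂ) / _), ← Finset.smul_sum]
  congr 1
  simp only [Finset.smul_sum]
  rw [Finset.sum_comm]
  refine Fintype.sum_equiv (Equiv.mulLeft g) _ _ fun m => ?_
  have h1 : s m = s g⁻¹ * s (g * m) := by rw [← map_mul]; simp
  have h2 : star (s m k l) = ∑ r, s g r k * star (s (g * m) r l) := by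
    rw [h1, Matrix.mul_apply, star_sum]
    exact Finset.sum_congr rfl fun r _ => by rw [hs.apply_inv, star_mul', star_star]
  rw [h2, Finset.sum_smul]
  exact Finset.sum_congr rfl fun r _ => by simp [mul_smul]

/-- Expanding the left operator and moving each `τ g` through the right one leaves a sum of
coefficient products, evaluated by Schur orthogonality. -/
lemma matrixUnit_matrixUnit (hs : IsUnitaryIrreducible s) (τ : Representation ℂ G H)
    (i j k l : Fin d) (x : H) :
    matrixUnit s τ i j (matrixUnit s τ k l x) = if j = k then matrixUnit s τ i l x else 0 := by
  have hG : (Fintype.card G : ℂ) ≠ 0 := by simp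
  have h1 : ∀ r, ((d : ℂ) / Fintype.card G) * ∑ g, star (s g i j) * s g r k =
      if i = r ∧ j = k then 1 else 0 := fun r => by
    have h := hs.sum_apply_mul_star_apply r k i j
    rw [div_mul_eq_mul_div, div_eq_iff hG]
    simp only [mul_comm (star _)]
    rw [h]
    by_cases hi : i = r <;> by_cases hj : j = k <;> simp [hi, hj, eq_comm]
  conv_lhs => rw [matrixUnit]
  simp only [LinearMap.smul_apply, LinearMap.sum_apply, hs.apply_matrixUnit, Finset.smul_sum]
  rw [Finset.sum_comm]
  simp only [smul_smul, ← Finset.sum_smul, ← Finset.mul_sum]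
  simp only [h1]
  by_cases hj : j = k <;> simp [hj, ite_smul]

lemma _root_.sum_matrixUnit (τ : Representation ℂ G H) :
    ∑ i, matrixUnit s τ i i =
      ((d : ℂ) / Fintype.card G) • ∑ g, star (s g).trace • τ g := by
  simp only [matrixUnit, ← Finset.smul_sum]
  rw [Finset.sum_comm]
  simp [← Finset.sum_smul, Matrix.trace]

end Algebra

variable {G H : Type*} [Group G] [Fintype G] [NormedAddCommGroup H] [InnerProductSpace ℂ H]
  {d : ℕ} {s : G →* Matrix (Fin d) (Fin d) ℂ} {τ : Representation ℂ G H}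

lemma inner_matrixUnit (hs : IsUnitaryIrreducible s)
    (hτ : ∀ g x y, inner ℂ (τ g x) (τ g y) = inner ℂ x y) (i j : Fin d) (x y : H) :
    inner ℂ (matrixUnit s τ i j x) y = inner ℂ x (matrixUnit s τ j i y) := by
  have h1 : ∀ g, inner ℂ (τ g x) y = inner ℂ x (τ g⁻¹ y) := fun g => by
    rw [← hτ g x, ← Module.End.mul_apply, ← map_mul]; simp
  simp only [matrixUnit, LinearMap.smul_apply, LinearMap.sum_apply, inner_smul_left,
    inner_smul_right, sum_inner, inner_sum, h1]
  congr 1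
  · simp
  · refine Fintype.sum_equiv (Equiv.inv G) _ _ fun g => ?_
    simp [hs.apply_inv]

variable [FiniteDimensional ℂ H]

/-- The isotypic component of `s` in a unitary representation `τ` is a tensor product of a
multiplicity space with the space of `s`. -/
lemma exists_tensor_equiv (hs : IsUnitaryIrreducible s) (hd : 0 < d)
    (hτ : ∀ g x y, inner ℂ (τ g x) (τ g y) = inner ℂ x y)
    {P : H →ₗ[ℂ] H} (hP : P = ∑ i, matrixUnit s τ i i) :
    ∃ (a : ℕ) (U : (EuclideanSpace ℂ (Fin a) ⊗[ℂ] EuclideanSpace ℂ (Fin d)) ≃ₗᵢ[ℂ]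
        LinearMap.range P),
      ((a * d : ℕ) : ℂ) = LinearMap.trace ℂ H P ∧
      ∀ g x, τ g (U x) = U (LinearMap.lTensor _ (Matrix.toEuclideanLin (s g)) x) := by
  have hPE : ∀ i j x, P (matrixUnit s τ i j x) = matrixUnit s τ i j x := fun i j x => by
    simp [hP, hs.matrixUnit_matrixUnit]
  have hPP : ∀ x ∈ LinearMap.range P, P x = x := by
    rintro _ ⟨x, rfl⟩
    conv_lhs => rw [hP]
    simp [hP, hs.matrixUnit_matrixUnit]
  let o : Fin d := ⟨0, hd⟩
  let A : Submodule ℂ H := LinearMap.range (matrixUnit s τ o o)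
  have hA : ∀ x ∈ A, matrixUnit s τ o o x = x := by
    rintro _ ⟨x, rfl⟩
    simp [hs.matrixUnit_matrixUnit]
  let b := stdOrthonormalBasis ℂ A
  -- `E_io` maps `A` isometrically onto the range of `E_ii`; these copies of an orthonormal basis of
  -- `A` form one of the range of `P`.
  let v : Fin (Module.finrank ℂ A) × Fin d → LinearMap.range P :=
    fun q => ⟨matrixUnit s τ q.2 o (b q.1), _, hPE _ _ _⟩
  have hv : Orthonormal ℂ v := by
    rw [orthonormal_iff_ite]
    rintro ⟨k, i⟩ ⟨l, j⟩
    change inner ℂ (matrixUnit s τ i o (b k : H)) (matrixUnit s τ j o (b l : H)) = _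
    have hb := orthonormal_iff_ite.mp b.orthonormal k l
    rw [hs.inner_matrixUnit hτ, hs.matrixUnit_matrixUnit]
    by_cases hij : i = j
    · rw [if_pos hij, hA _ (b l).2]
      simpa [hij] using hb
    · simp [hij]
  have hspan : ⊤ ≤ Submodule.span ℂ (Set.range v) := by
    rintro ⟨y, hy⟩ -
    -- `y = P y = ∑ E_io (E_oi y)`, and each `E_oi y` lies in `A`.
    have h1 : (⟨y, hy⟩ : LinearMap.range P) =
        ∑ i, ∑ k, b.repr ⟨matrixUnit s τ o i y, matrixUnit s τ o i y,
          by simp [hs.matrixUnit_matrixUnit]⟩ k • v (k, i) := by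
      apply Subtype.ext
      change y = _
      conv_lhs => rw [← hPP y hy, hP]
      simp only [LinearMap.sum_apply, AddSubmonoidClass.coe_finsetSum, Submodule.coe_smul, v]
      refine Finset.sum_congr rfl fun i _ => ?_
      have h2 := congrArg (fun z : A => matrixUnit s τ i o (z : H))
        (b.sum_repr ⟨matrixUnit s τ o i y, matrixUnit s τ o i y,
          by simp [hs.matrixUnit_matrixUnit]⟩)
      simp only [AddSubmonoidClass.coe_finsetSum, Submodule.coe_smul, map_sum, map_smul,
        hs.matrixUnit_matrixUnit, if_true] at h2
      exact h2.symm
    rw [h1]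
    exact Submodule.sum_mem _ fun i _ => Submodule.sum_mem _ fun k _ =>
      Submodule.smul_mem _ _ (Submodule.subset_span ⟨_, rfl⟩)
  let U := ((EuclideanSpace.basisFun (Fin (Module.finrank ℂ A)) ℂ).tensorProduct
    (EuclideanSpace.basisFun (Fin d) ℂ)).equiv (OrthonormalBasis.mk hv hspan) (Equiv.refl _)
  have hU : ∀ k i, (U (EuclideanSpace.basisFun _ ℂ k ⊗ₜ EuclideanSpace.basisFun _ ℂ i) : H) =
      matrixUnit s τ i o (b k) := fun k i => by
    rw [← OrthonormalBasis.tensorProduct_apply]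
    simp only [U, OrthonormalBasis.equiv_apply_basis, OrthonormalBasis.coe_mk]
    rfl
  refine ⟨_, U, ?_, fun g x => ?_⟩
  · have h1 : LinearMap.IsProj (LinearMap.range P) P :=
      ⟨fun x => ⟨x, rfl⟩, hPP⟩
    rw [h1.trace, ← U.toLinearEquiv.finrank_eq]
    simp
  · let F : _ →ₗ[ℂ] H := τ g ∘ₗ (LinearMap.range P).subtype ∘ₗ U.toLinearEquiv.toLinearMap
    let F' : _ →ₗ[ℂ] H := (LinearMap.range P).subtype ∘ₗ U.toLinearEquiv.toLinearMap ∘ₗ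
      LinearMap.lTensor _ (Matrix.toEuclideanLin (s g))
    have hF : F = F' := by
      refine ((EuclideanSpace.basisFun _ ℂ).tensorProduct
        (EuclideanSpace.basisFun (Fin d) ℂ)).toBasis.ext ?_
      rintro ⟨k, i⟩
      have h3 : Matrix.toEuclideanLin (s g) (EuclideanSpace.basisFun _ ℂ i) =
          ∑ r, s g r i • EuclideanSpace.basisFun _ ℂ r := by
        ext r
        simp [Matrix.toEuclideanLin, Pi.single_apply]
      simp only [OrthonormalBasis.coe_toBasis, OrthonormalBasis.tensorProduct_apply]
      change τ g (U _ : H) = (U (EuclideanSpace.basisFun _ ℂ k ⊗ₜ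
        Matrix.toEuclideanLin (s g) (EuclideanSpace.basisFun _ ℂ i)) : H)
      rw [h3, TensorProduct.tmul_sum, map_sum, hU, hs.apply_matrixUnit]
      simp only [TensorProduct.tmul_smul, map_smul, AddSubmonoidClass.coe_finsetSum,
        Submodule.coe_smul, hU]
    exact LinearMap.congr_fun hF x

end IsUnitaryIrreducible

/-! ### The commutator pairing in groups of class two. -/

section CommutatorPairing

variable {E : Type*} [Group E]

lemma commutatorElement_mem_center (hE : commutator E ≤ Subgroup.center E) (g h : E) :
    ⁅g, h⁆ ∈ Subgroup.center E :=
  hE (Subgroup.commutator_mem_commutator (Subgroup.mem_top g) (Subgroup.mem_top h))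

/-- In a group of class two, `⁅g, ·⁆` is a homomorphism to the centre. -/
def commutatorHom (hE : commutator E ≤ Subgroup.center E) (g : E) : E →* Subgroup.center E where
  toFun h := ⟨⁅g, h⁆, commutatorElement_mem_center hE g h⟩
  map_one' := by ext; simp
  map_mul' h k := by
    ext
    have hc := Subgroup.mem_center_iff.mp (commutatorElement_mem_center hE g k)
    calc ⁅g, h * k⁆ = g * h * g⁻¹ * ⁅g, k⁆ * h⁻¹ := by simp [commutatorElement_def, mul_assoc]
      _ = g * h * g⁻¹ * (⁅g, k⁆ * h⁻¹) := by rw [mul_assoc]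
      _ = ⁅g, h⁆ * ⁅g, k⁆ := by rw [← hc]; simp [commutatorElement_def, mul_assoc]

@[simp] lemma coe_commutatorHom (hE : commutator E ≤ Subgroup.center E) (g h : E) :
    (commutatorHom hE g h : E) = ⁅g, h⁆ := rfl

lemma commute_inv_mul_of_commutatorElement_eq (hE : commutator E ≤ Subgroup.center E)
    {g h n : E} (H : ⁅g, n⁆ = ⁅h, n⁆) : Commute (g⁻¹ * h) n := by
  have h1 : commutatorHom hE n g = commutatorHom hE n h := by
    ext
    rw [coe_commutatorHom, coe_commutatorHom, ← commutatorElement_inv g, ← commutatorElement_inv h,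
      H]
  have h2 : commutatorHom hE n (g⁻¹ * h) = 1 := by rw [map_mul, map_inv, h1, inv_mul_cancel]
  have h3 : ⁅n, g⁻¹ * h⁆ = 1 := congrArg Subtype.val h2
  exact (commutatorElement_eq_one_iff_commute.mp h3).symm

/-- Dedekind: distinct characters are linearly independent in the `|Q|`-dimensional space of
functions on `Q`. -/
lemma card_monoidHom_le (Q : Type*) [Group Q] [Finite Q] :
    Finite (Q →* ℂ) ∧ Nat.card (Q →* ℂ) ≤ Nat.card Q := by
  cases nonempty_fintype Q
  have h := linearIndependent_monoidHom Q ℂ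
  have hf : Finite (Q →* ℂ) := h.finite
  cases nonempty_fintype (Q →* ℂ)
  refine ⟨hf, ?_⟩
  have := h.fintype_card_le_finrank
  simpa [Nat.card_eq_fintype_card] using this

/-- In a finite group of class two with a faithful linear character of the centre, the centralizer
of the centre of a subgroup `N` is contained in `N C(N)`. -/
lemma mem_mul_centralizer_of_commute [Finite E] (hE : commutator E ≤ Subgroup.center E)
    (ω : Subgroup.center E →* ℂ) (hω : Function.Injective ω) (N : Subgroup E) {e : E}
    (he : ∀ z ∈ Subgroup.center N, Commute e (z : E)) :
    e ∈ (N : Set E) * (Subgroup.centralizer (N : Set E) : Set E) := by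
  -- An element commuting with `Z(N)` induces the linear character `n ↦ ω ⁅g, n⁆` of `N / Z(N)`.
  let f : ∀ g : E, (∀ z ∈ Subgroup.center N, Commute g (z : E)) → (N ⧸ Subgroup.center N →* ℂ) :=
    fun g hg => QuotientGroup.lift (Subgroup.center N)
      (ω.comp ((commutatorHom hE g).comp N.subtype)) (fun z hz => by
        have : commutatorHom hE g (z : E) = 1 :=
          Subtype.ext (commutatorElement_eq_one_iff_commute.mpr (hg z hz))
        change ω (commutatorHom hE g (z : E)) = 1
        rw [this, map_one])
  have hf : ∀ g h hg hh, f g hg = f h hh → ∀ n : N, ⁅g, (n : E)⁆ = ⁅h, (n : E)⁆ := by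
    intro g h hg hh H n
    have h1 : ω (commutatorHom hE g n) = ω (commutatorHom hE h n) :=
      DFunLike.congr_fun H (QuotientGroup.mk n)
    exact congrArg Subtype.val (hω h1)
  have hN : ∀ m : N, ∀ z ∈ Subgroup.center N, Commute (m : E) (z : E) := fun m z hz =>
    congrArg Subtype.val (Subgroup.mem_center_iff.mp hz m)
  -- The characters coming from `N` itself are pairwise distinct, so by counting they are all of
  -- them; hence `e` has the same commutators with `N` as some element of `N`.
  let F : N ⧸ Subgroup.center N → (N ⧸ Subgroup.center N →* ℂ) := fun q => f q.out (hN q.out)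
  have hF : Function.Injective F := by
    intro q r hqr
    have h1 := hf _ _ (hN q.out) (hN r.out) hqr
    rw [← q.out_eq', ← r.out_eq']
    refine QuotientGroup.eq.mpr (Subgroup.mem_center_iff.mpr fun n => ?_)
    exact Subtype.ext (commute_inv_mul_of_commutatorElement_eq hE (h1 n)).symm
  obtain ⟨hfin, hcard⟩ := card_monoidHom_le (N ⧸ Subgroup.center N)
  obtain ⟨q, hq⟩ := (hF.bijective_of_nat_card_le hcard).2 (f e he)
  have h1 := hf _ _ (hN q.out) he hq
  refine ⟨q.out, (q.out).2, (q.out : E)⁻¹ * e, ?_, by simp⟩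
  exact Subgroup.mem_centralizer_iff.mpr fun n hn =>
    (commute_inv_mul_of_commutatorElement_eq hE (h1 ⟨n, hn⟩)).symm

end CommutatorPairing

/-! ### Extraspecial groups, central characters and vanishing of characters. -/

/-- A noncentral `n ∈ N` has a nontrivial commutator, which lies in `N` and in the centre; the
centre has prime order, so meeting `N` nontrivially it is contained in `N`. -/
lemma IsExtraspecial.center_le {p : ℕ} {E : Type*} [Group E] (hE : IsExtraspecial p E)
    {N : Subgroup E} (hN : N.Normal) (hN1 : N ≠ ⊥) : Subgroup.center E ≤ N := by
  obtain ⟨z, hzN, hzZ, hz1⟩ : ∃ z, z ∈ N ∧ z ∈ Subgroup.center E ∧ z ≠ 1 := by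
    obtain ⟨n, hn, hn1⟩ := (Subgroup.bot_or_exists_ne_one N).resolve_left hN1
    by_cases hnZ : n ∈ Subgroup.center E
    · exact ⟨n, hn, hnZ, hn1⟩
    · obtain ⟨g, hg⟩ := not_forall.mp fun H => hnZ (Subgroup.mem_center_iff.mpr H)
      exact ⟨⁅g, n⁆, N.mul_mem (hN.conj_mem n hn g) (N.inv_mem hn),
        commutatorElement_mem_center hE.commutator_eq_center.le g n,
        fun h => hg (commutatorElement_eq_one_iff_mul_comm.mp h)⟩
  have : Fact (Nat.card (Subgroup.center E)).Prime := ⟨hE.card_center ▸ hE.prime⟩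
  have h1 := (N.subgroupOf (Subgroup.center E)).eq_bot_or_eq_top_of_prime_card
  rcases h1 with h1 | h1
  · have : (⟨z, hzZ⟩ : Subgroup.center E) ∈ N.subgroupOf (Subgroup.center E) := hzN
    rw [h1, Subgroup.mem_bot] at this
    exact absurd (congrArg Subtype.val this) hz1
  · exact Subgroup.subgroupOf_eq_top.mp h1

lemma IsExtraspecial.commutator_le {p : ℕ} {E : Type*} [Group E] (hE : IsExtraspecial p E) :
    commutator E ≤ Subgroup.center E :=
  hE.commutator_eq_center.le

/-- The central character of a faithful irreducible representation. -/
lemma exists_centralCharacter {E V : Type*} [Group E] [AddCommGroup V] [Module ℂ V]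
    [FiniteDimensional ℂ V] {ρ : Representation ℂ E V} (hρ : ρ.IsIrreducible)
    (hinj : Function.Injective ρ) :
    ∃ ω : Subgroup.center E →* ℂ, Function.Injective ω ∧
      ∀ z : Subgroup.center E, ρ z = ω z • LinearMap.id := by
  have h1 : ∀ z : Subgroup.center E, ∃ c : ℂ, ρ z = c • LinearMap.id := fun z =>
    hρ.exists_eq_smul_id (ρ z) fun g => by
      rw [← Module.End.mul_eq_comp, ← Module.End.mul_eq_comp, ← map_mul, ← map_mul,
        Subgroup.mem_center_iff.mp z.2 g]
  choose c hc using h1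
  have : Nontrivial V := by
    by_contra hV
    rw [not_nontrivial_iff_subsingleton] at hV
    obtain ⟨W, W', hW⟩ := (hρ.toNontrivial).exists_pair_ne
    refine hW (SetLike.ext fun x => ?_)
    rw [Subsingleton.elim x 0]
    exact ⟨fun _ => W'.toSubmodule.zero_mem, fun _ => W.toSubmodule.zero_mem⟩
  obtain ⟨v, hv⟩ := exists_ne (0 : V)
  have h2 : ∀ z : Subgroup.center E, ρ z v = c z • v := fun z => by rw [hc]; rfl
  refine ⟨⟨⟨c, ?_⟩, ?_⟩, ?_, hc⟩
  · have := h2 1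
    simp only [Subgroup.coe_one, map_one, Module.End.one_apply] at this
    exact smul_left_injective ℂ hv (by simpa using this.symm)
  · intro y z
    have := h2 (y * z)
    simp only [Subgroup.coe_mul, map_mul, Module.End.mul_apply, h2, map_smul] at this
    exact smul_left_injective ℂ hv (by simpa [smul_smul, mul_comm] using this.symm)
  · intro y z hyz
    apply Subtype.ext
    apply hinj
    have : c y = c z := hyz
    rw [hc, hc, this]

lemma Representation.character_eq_zero_of_commutatorElement {G V : Type*} [Group G]
    [AddCommGroup V] [Module ℂ V] (ρ : Representation ℂ G V) {g h : G} {c : ℂ} (hc : c ≠ 1)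
    (h1 : ρ ⁅h, g⁆ = c • LinearMap.id) : ρ.character g = 0 := by
  have h2 : ρ.character (h * g * h⁻¹) = ρ.character g := ρ.char_conj g h
  have h3 : h * g * h⁻¹ = ⁅h, g⁆ * g := by simp [commutatorElement_def]
  rw [h3, Representation.character, map_mul, h1] at h2
  have h4 : c * ρ.character g = ρ.character g := by
    simpa [Representation.character, smul_mul_assoc, ← Module.End.one_eq_id] using h2
  have h5 : (c - 1) * ρ.character g = 0 := by linear_combination h4
  exact (mul_eq_zero.mp h5).resolve_left (sub_ne_zero.mpr hc)

lemma character_eq_zero_of_notMem_center {E V : Type*} [Group E] [AddCommGroup V] [Module ℂ V]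
    (hE : commutator E ≤ Subgroup.center E) {ρ : Representation ℂ E V}
    {ω : Subgroup.center E →* ℂ} (hω : Function.Injective ω)
    (hρ : ∀ z : Subgroup.center E, ρ z = ω z • LinearMap.id) {g : E}
    (hg : g ∉ Subgroup.center E) : ρ.character g = 0 := by
  obtain ⟨h, hh⟩ := not_forall.mp fun H => hg (Subgroup.mem_center_iff.mpr H)
  refine ρ.character_eq_zero_of_commutatorElement (h := h) (c := ω (commutatorHom hE h g)) ?_
    (hρ (commutatorHom hE h g))
  rw [← map_one ω, hω.ne_iff]
  exact fun H => hh (commutatorElement_eq_one_iff_mul_comm.mp (congrArg Subtype.val H))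

/-! ### Traces of the Clifford projector and degrees of characters. -/

lemma cliffordProjector_eq_sum {E H : Type*} [Group E] [NormedAddCommGroup H]
    [InnerProductSpace ℂ H] (ρ : Representation ℂ E H) (N : Subgroup E) [Fintype N] (χ : N → ℂ) :
    cliffordProjector ρ N χ = (χ 1 / Fintype.card N) • ∑ n : N, χ n⁻¹ • ρ (n : E) := by
  rw [cliffordProjector, finsum_eq_sum_of_fintype, Nat.card_eq_fintype_card]

lemma trace_mul_cliffordProjector {E H : Type*} [Group E] [NormedAddCommGroup H]
    [InnerProductSpace ℂ H] (ρ : Representation ℂ E H) (N : Subgroup E) [Fintype N] (χ : N → ℂ)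
    (g : E) :
    LinearMap.trace ℂ H (ρ g ∘ₗ cliffordProjector ρ N χ) =
      χ 1 / Fintype.card N * ∑ n : N, χ n⁻¹ * ρ.character (g * n) := by
  rw [cliffordProjector_eq_sum, ← Module.End.mul_eq_comp, mul_smul_comm, Finset.mul_sum, map_smul,
    map_sum, smul_eq_mul]
  congr 1
  refine Finset.sum_congr rfl fun n _ => ?_
  rw [mul_smul_comm, ← map_mul, map_smul, smul_eq_mul, Representation.character]

lemma trace_cliffordProjector {E H : Type*} [Group E] [NormedAddCommGroup H]
    [InnerProductSpace ℂ H] (ρ : Representation ℂ E H) (N : Subgroup E) [Fintype N] (χ : N → ℂ) :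
    LinearMap.trace ℂ H (cliffordProjector ρ N χ) =
      χ 1 * characterScalarProduct χ (fun n : N => ρ.character (n : E)) := by
  have h := trace_mul_cliffordProjector ρ N χ 1
  rw [map_one, Module.End.one_eq_id, LinearMap.id_comp] at h
  rw [h, characterScalarProduct, finsum_eq_sum_of_fintype, Nat.card_eq_fintype_card,
    div_eq_mul_inv, mul_assoc]
  congr 2
  exact Fintype.sum_equiv (Equiv.inv N) _ _ fun n => by simp

lemma cliffordProjector_eq_sum_matrixUnit {E H : Type*} [Group E] [NormedAddCommGroup H]
    [InnerProductSpace ℂ H] (ρ : Representation ℂ E H) (N : Subgroup E) [Fintype N] (χ : N → ℂ)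
    {d : ℕ} {s : N →* Matrix (Fin d) (Fin d) ℂ} (hs : IsUnitaryIrreducible s)
    (hχ : ∀ n, (s n).trace = χ n) :
    cliffordProjector ρ N χ = ∑ i, matrixUnit s (ρ.comp N.subtype) i i := by
  rw [cliffordProjector_eq_sum, sum_matrixUnit]
  have h1 : χ 1 = d := by rw [← hχ]; simp
  rw [h1]
  congr 1
  refine Finset.sum_congr rfl fun n _ => ?_
  rw [← Matrix.trace_conjTranspose, ← hs.inv_eq, hχ]
  rfl

lemma Nat.card_subtype_mem {G : Type*} [Group G] [Finite G] (K N : Subgroup G) :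
    Nat.card {n : N // (n : G) ∈ K} = Nat.card (K ⊓ N : Subgroup G) :=
  Nat.card_congr
    ⟨fun n => ⟨n.1, n.2, n.1.2⟩, fun n => ⟨⟨n.1, n.2.2⟩, n.2.1⟩, fun _ => rfl, fun _ => rfl⟩

lemma IsUnitaryIrreducible.exists_eq_smul_one {G : Type*} [Group G] {d : ℕ}
    {s : G →* Matrix (Fin d) (Fin d) ℂ} (hs : IsUnitaryIrreducible s) {z : G}
    (hz : z ∈ Subgroup.center G) : ∃ c : ℂ, s z = c • 1 :=
  hs.scalar_of_commute _ fun g => by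
    rw [← map_mul, ← map_mul, Subgroup.mem_center_iff.mp hz g]

/-- An irreducible character vanishing off the centre has degree `|G : Z(G)| ^ (1/2)`. -/
lemma IsUnitaryIrreducible.sq_eq_index_center {G : Type*} [Group G] [Fintype G] {d : ℕ}
    {s : G →* Matrix (Fin d) (Fin d) ℂ} (hs : IsUnitaryIrreducible s)
    (hnorm : ∑ g, (s g).trace * (s g⁻¹).trace = Fintype.card G)
    (h0 : ∀ g ∉ Subgroup.center G, (s g).trace = 0) :
    d ^ 2 = (Subgroup.center G).index := by
  classical
  -- On the centre `s g` and `s g⁻¹` are mutually inverse scalars, so their traces multiply to `d ^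
  -- 2`.
  have h1 : ∀ g, (s g).trace * (s g⁻¹).trace = if g ∈ Subgroup.center G then (d : ℂ) ^ 2 else 0 := by
    intro g
    split_ifs with hg
    · obtain ⟨c, hc⟩ := hs.exists_eq_smul_one hg
      obtain ⟨c', hc'⟩ := hs.exists_eq_smul_one (inv_mem hg)
      have h2 : s g * s g⁻¹ = 1 := by rw [← map_mul]; simp
      rw [hc, hc'] at h2 ⊢
      have h3 := congrArg Matrix.trace h2
      simp only [Matrix.mul_smul, mul_one, Matrix.trace_smul, Matrix.trace_one,
        Fintype.card_fin, smul_eq_mul] at h3 ⊢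
      linear_combination (d : ℂ) * h3
    · rw [h0 g hg, zero_mul]
  simp only [h1, Finset.sum_ite, Finset.sum_const_zero, add_zero, Finset.sum_const, nsmul_eq_mul]
    at hnorm
  have h2 : (Finset.univ.filter fun g : G => g ∈ Subgroup.center G).card =
      Nat.card (Subgroup.center G) := by
    rw [Nat.card_eq_fintype_card, Fintype.card_subtype]
  rw [h2, ← Nat.card_eq_fintype_card, ← Subgroup.card_mul_index (Subgroup.center G)] at hnorm
  have h3 : (Nat.card (Subgroup.center G) : ℂ) ≠ 0 := by
    exact_mod_cast Nat.card_pos.ne'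
  push_cast at hnorm
  exact_mod_cast mul_left_cancel₀ h3 hnorm

lemma LinearMap.lTensor_euclideanSpace_injective {a : ℕ} (ha : a ≠ 0) {B : Type*}
    [NormedAddCommGroup B] [InnerProductSpace ℂ B] :
    Function.Injective fun M : B →ₗ[ℂ] B => LinearMap.lTensor (EuclideanSpace ℂ (Fin a)) M := by
  intro M M' h
  ext u
  let v : EuclideanSpace ℂ (Fin a) := EuclideanSpace.basisFun _ ℂ ⟨0, Nat.pos_of_ne_zero ha⟩
  have h1 : v ⊗ₜ[ℂ] M u = v ⊗ₜ[ℂ] M' u := LinearMap.congr_fun h (v ⊗ₜ u)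
  have h2 : v ⊗ₜ[ℂ] (M u - M' u) = 0 := by rw [TensorProduct.tmul_sub, h1, sub_self]
  have h3 := congrArg norm h2
  rw [TensorProduct.norm_tmul, OrthonormalBasis.norm_eq_one, one_mul, norm_zero, norm_eq_zero] at h3
  exact sub_eq_zero.mp h3

lemma IsUnitaryIrreducible.exists_eq_smul_id_of_commute {G : Type*} [Group G] {d : ℕ}
    {s : G →* Matrix (Fin d) (Fin d) ℂ} (hs : IsUnitaryIrreducible s)
    (M : EuclideanSpace ℂ (Fin d) →ₗ[ℂ] EuclideanSpace ℂ (Fin d))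
    (hM : ∀ g, M ∘ₗ Matrix.toEuclideanLin (s g) = Matrix.toEuclideanLin (s g) ∘ₗ M) :
    ∃ c : ℂ, M = c • LinearMap.id := by
  obtain ⟨X, rfl⟩ := Matrix.toEuclideanLin.surjective M
  obtain ⟨c, hc⟩ := hs.scalar_of_commute X fun g => by
    apply Matrix.toEuclideanLin.injective
    have h := hM g
    rwa [← Matrix.toLpLin_mul_same, ← Matrix.toLpLin_mul_same] at h
  exact ⟨c, by rw [hc, map_smul, Matrix.toLpLin_one]⟩

open scoped ComplexOrder in
lemma IsCliffordData.characterScalarProduct_ne_zero {E H : Type*} [Group E]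
    [NormedAddCommGroup H] [InnerProductSpace ℂ H] {ρ : Representation ℂ E H} {N : Subgroup E}
    {χ : N → ℂ} (hC : IsCliffordData ρ N χ) :
    characterScalarProduct χ (fun n : N => ρ.character (n : E)) ≠ 0 :=
  hC.pos.ne'

/-! ### The Clifford code as a subsystem code. -/

theorem theorem3 {E H : Type*} [Group E]
    [NormedAddCommGroup H] [InnerProductSpace ℂ H] [FiniteDimensional ℂ H]
    (p : ℕ) (hE : IsExtraspecial p E)
    (ρ : Representation ℂ E H) (N : Subgroup E) (χ : N → ℂ)
    (hC : IsCliffordData ρ N χ) (hN : N ≠ ⊥) :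
    ∃ (a b : ℕ) (U : (EuclideanSpace ℂ (Fin a) ⊗[ℂ] EuclideanSpace ℂ (Fin b)) ≃ₗᵢ[ℂ]
        cliffordCode ρ N χ),
      (Module.finrank ℂ (EuclideanSpace ℂ (Fin a)) : ℝ) =
          (Nat.card (Subgroup.center E ⊓ N : Subgroup E) : ℝ) *
            √((Subgroup.center E).index : ℝ) * √((Subgroup.center N).index : ℝ) /
              (Nat.card N : ℝ) ∧
      (Module.finrank ℂ (EuclideanSpace ℂ (Fin b)) : ℝ) = √((Subgroup.center N).index : ℝ) ∧
      {e : E | IsDetectableBySubsystem (cliffordCode ρ N χ) U (ρ e)} =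
        Set.univ \ (((N : Set E) * (Subgroup.centralizer (N : Set E) : Set E)) \ (N : Set E)) := by
  classical
  have : Finite E := hE.finite
  have : Fintype N := Fintype.ofFinite N
  have hcN : (Fintype.card N : ℂ) ≠ 0 := by simp
  obtain ⟨d, σ, hσ, rfl⟩ := hC.irreducibleCharacter
  obtain ⟨s, hs, hsχ⟩ := exists_isUnitaryIrreducible σ hσ
  have hρ := hC.errorRepresentation
  obtain ⟨ω, hω, hρω⟩ := exists_centralCharacter hρ.irreducible hρ.faithful
  have hZN := hE.center_le hC.normal hN
  have hφ : ∀ g ∉ Subgroup.center E, ρ.character g = 0 := fun g hg =>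
    character_eq_zero_of_notMem_center hE.commutator_le hω hρω hg
  have hP := cliffordProjector_eq_sum_matrixUnit ρ N _ hs hsχ
  have hχ1 : σ.character 1 = d := by simp [Representation.char_one]
  have hd : d ≠ 0 := by
    rintro rfl
    refine hC.characterScalarProduct_ne_zero ?_
    have h1 : ∀ n, σ.character n = 0 := fun n => by rw [← hsχ]; simp [Matrix.trace]
    simp [characterScalarProduct, h1]
  have htr : LinearMap.trace ℂ H (cliffordProjector ρ N σ.character) ≠ 0 := by
    rw [trace_cliffordProjector, hχ1]
    exact mul_ne_zero (Nat.cast_ne_zero.mpr hd) hC.characterScalarProduct_ne_zero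
  obtain ⟨a, U, had, hU⟩ : ∃ (a : ℕ) (U : (EuclideanSpace ℂ (Fin a) ⊗[ℂ]
      EuclideanSpace ℂ (Fin d)) ≃ₗᵢ[ℂ] cliffordCode ρ N σ.character),
      ((a * d : ℕ) : ℂ) = LinearMap.trace ℂ H (cliffordProjector ρ N σ.character) ∧
      ∀ (n : N) x, ρ (n : E) (U x) =
        U (LinearMap.lTensor _ (Matrix.toEuclideanLin (s n)) x) :=
    hs.exists_tensor_equiv (τ := ρ.comp N.subtype) (Nat.pos_of_ne_zero hd)
      (fun g => hρ.unitary g) hP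
  have ha : a ≠ 0 := by
    rintro rfl
    exact htr (by rw [← had]; simp)
  obtain ⟨x₀, hx₀⟩ : ∃ x, cliffordProjector ρ N σ.character x ≠ 0 := by
    by_contra! h
    exact htr (by rw [LinearMap.ext h (g := 0), map_zero])
  have hscal : ∀ (z : N) (c : ℂ), s z = c • 1 → ∀ y ∈ cliffordCode ρ N σ.character,
      ρ (z : E) y = c • y := by
    intro z c hz y hy
    obtain ⟨x, hx⟩ := U.surjective ⟨y, hy⟩
    have h1 := hU z x
    rw [hx, hz, map_smul, Matrix.toLpLin_one, LinearMap.lTensor_smul, LinearMap.lTensor_id,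
      LinearMap.smul_apply, LinearMap.id_apply, map_smul, hx] at h1
    exact h1
  -- `χ` lies over `ω`: on the nonzero vector `P x₀` of `C`, the scalars of `s z` and `ρ z` must
  -- agree.
  have hcenter : ∀ z : Subgroup.center E, s ⟨z, hZN z.2⟩ = ω z • 1 := by
    intro z
    have hz : (⟨z, hZN z.2⟩ : N) ∈ Subgroup.center N := Subgroup.mem_center_iff.mpr fun n =>
      Subtype.ext (Subgroup.mem_center_iff.mp z.2 n)
    obtain ⟨c, hc⟩ := hs.exists_eq_smul_one hz
    have h1 := hscal _ c hc _ ⟨x₀, rfl⟩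
    simp only [hρω, LinearMap.smul_apply, LinearMap.id_apply] at h1
    rw [hc, smul_left_injective ℂ hx₀ h1]
  have hs0 : ∀ n ∉ Subgroup.center N, (s n).trace = 0 := by
    intro n hn
    obtain ⟨h, hh⟩ := not_forall.mp fun H => hn (Subgroup.mem_center_iff.mpr H)
    have h1 : s ⁅h, n⁆ = ω (commutatorHom hE.commutator_le (h : E) n) • 1 :=
      hcenter (commutatorHom hE.commutator_le (h : E) n)
    have h2 : ω (commutatorHom hE.commutator_le (h : E) n) ≠ 1 := by
      rw [← map_one ω, hω.ne_iff]
      intro H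
      have h3 : ⁅(h : E), (n : E)⁆ = 1 := congrArg Subtype.val H
      exact hh (Subtype.ext (commutatorElement_eq_one_iff_mul_comm.mp h3))
    have h4 : (s (⁅h, n⁆ * n)).trace = (s n).trace := by
      have h5 : ⁅h, n⁆ * n = h * n * h⁻¹ := by simp [commutatorElement_def]
      rw [h5, map_mul, Matrix.trace_mul_comm, ← map_mul]
      simp
    rw [map_mul, h1, smul_mul_assoc, one_mul, Matrix.trace_smul, smul_eq_mul] at h4
    exact (mul_left_eq_self₀.mp h4).resolve_left h2
  have hd2 : d ^ 2 = (Subgroup.center N).index := by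
    refine hs.sq_eq_index_center ?_ hs0
    have : Invertible (Nat.card N : ℂ) :=
      invertibleOfNonzero (by rwa [Nat.card_eq_fintype_card])
    have h1 := Representation.char_orthonormal σ σ
    rw [if_pos ⟨Representation.Equiv.refl σ⟩, Nat.card_eq_fintype_card,
      inv_mul_eq_iff_eq_mul₀ hcN, mul_one] at h1
    simpa only [hsχ] using h1
  have hdR : (d : ℝ) = √((Subgroup.center N).index : ℝ) := by
    rw [← hd2]; simp
  -- The trace of `P` computed twice: it is `a * d`, and in the defining sum only `n ∈ Z(E) ∩ N`
  -- contribute, each giving `d * dim H`. One factor `d` cancels.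
  have haN : a * Nat.card N =
      Nat.card (Subgroup.center E ⊓ N : Subgroup E) * Module.finrank ℂ H * d := by
    have h1 := trace_mul_cliffordProjector ρ N σ.character 1
    have h2 : ∀ n : N, σ.character n⁻¹ * ρ.character (1 * n) =
        if (n : E) ∈ Subgroup.center E then (d : ℂ) * Module.finrank ℂ H else 0 := by
      intro n
      rw [one_mul]
      split_ifs with hn
      · have h3 : s n⁻¹ = ω ⟨n, hn⟩⁻¹ • 1 := hcenter ⟨n, hn⟩⁻¹
        have h4 : σ.character n⁻¹ = ω ⟨n, hn⟩⁻¹ * d := by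
          rw [← hsχ]
          simpa using congrArg Matrix.trace h3
        have h5 : ρ.character n = ω ⟨n, hn⟩ * Module.finrank ℂ H := by
          have := congrArg (LinearMap.trace ℂ H) (hρω ⟨n, hn⟩)
          simpa [Representation.character] using this
        have h6 : ω ⟨n, hn⟩⁻¹ * ω ⟨n, hn⟩ = 1 := by rw [← map_mul, inv_mul_cancel, map_one]
        rw [h4, h5]
        linear_combination (d : ℂ) * Module.finrank ℂ H * h6
      · rw [hφ n hn, mul_zero]
    rw [map_one, Module.End.one_eq_id, LinearMap.id_comp, ← had, Finset.sum_congr rfl fun n _ => h2 n,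
      hχ1, Finset.sum_ite, Finset.sum_const_zero, add_zero, Finset.sum_const, nsmul_eq_mul,
      ← Fintype.card_subtype, ← Nat.card_eq_fintype_card, ← Nat.card_eq_fintype_card,
      Nat.card_subtype_mem, div_mul_eq_mul_div, eq_div_iff (by rwa [Nat.card_eq_fintype_card])] at h1
    have hdC : (d : ℂ) ≠ 0 := Nat.cast_ne_zero.mpr hd
    have h3 : ((a * Nat.card N : ℕ) : ℂ) =
        (Nat.card (Subgroup.center E ⊓ N : Subgroup E) * Module.finrank ℂ H * d : ℕ) := by
      apply mul_left_cancel₀ hdC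
      push_cast at h1 ⊢
      linear_combination h1
    exact_mod_cast h3
  refine ⟨a, d, U, ?_, by simpa using hdR, ?_⟩
  · have h1 : (Nat.card N : ℝ) ≠ 0 := Nat.cast_ne_zero.mpr Nat.card_pos.ne'
    rw [finrank_euclideanSpace_fin, eq_div_iff h1, ← hρ.degree, ← hdR]
    exact_mod_cast haN
  have hdet_mem : ∀ e ∈ N,
      IsDetectableBySubsystem (cliffordCode ρ N σ.character) U (ρ e) := by
    intro e he
    refine ⟨Matrix.toEuclideanLin (s ⟨e, he⟩), fun x => ?_⟩
    rw [show ρ e (U x) = _ from hU ⟨e, he⟩ x]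
    exact Submodule.orthogonalProjectionOnto_mem_subspace_eq_self _
  have hdet_notMem : ∀ e ∉ (N : Set E) * (Subgroup.centralizer (N : Set E) : Set E),
      IsDetectableBySubsystem (cliffordCode ρ N σ.character) U (ρ e) := by
    intro e he
    obtain ⟨z, hz, hez⟩ : ∃ z ∈ Subgroup.center N, ¬ Commute e (z : E) := by
      by_contra! h
      exact he (mem_mul_centralizer_of_commute hE.commutator_le ω hω N h)
    obtain ⟨c, hc⟩ := hs.exists_eq_smul_one hz
    -- The compression vanishes: the unitary `ρ z` acts by `c` on `C` and by `ω u * c` on `ρ e C`,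
    -- with `ω u ≠ 1`.
    refine ⟨0, fun x => ?_⟩
    rw [LinearMap.lTensor_zero, LinearMap.zero_apply, map_zero,
      Submodule.orthogonalProjectionOnto_eq_zero_iff, Submodule.mem_orthogonal]
    intro w hw
    rcases eq_or_ne w 0 with rfl | hw0
    · exact inner_zero_left _
    have hcc : star c * c = 1 := by
      have h1 := hρ.unitary (z : E) w w
      rw [hscal z c hc w hw, inner_smul_left, inner_smul_right, ← mul_assoc] at h1
      exact mul_right_cancel₀ (inner_self_ne_zero.mpr hw0) (h1.trans (one_mul _).symm)
    let u := commutatorHom hE.commutator_le (z : E) e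
    have hu : ω u ≠ 1 := by
      rw [← map_one ω, hω.ne_iff]
      intro H
      exact hez (commutatorElement_eq_one_iff_commute.mp (congrArg Subtype.val H)).symm
    have h2 : ρ (z : E) (ρ e (U x)) = (ω u * c) • ρ e (U x) := by
      have h3 : (z : E) * e = u * (e * z) := by simp [u, commutatorElement_def, mul_assoc]
      rw [← Module.End.mul_apply, ← map_mul, h3, map_mul, map_mul, Module.End.mul_apply,
        Module.End.mul_apply, hscal z c hc _ (U x).2, hρω, map_smul, LinearMap.smul_apply,
        LinearMap.id_apply, smul_smul]
    have h4 := hρ.unitary (z : E) w (ρ e (U x))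
    rw [hscal z c hc w hw, h2, inner_smul_left, inner_smul_right] at h4
    have h5 : (ω u - 1) * inner ℂ w (ρ e (U x)) = 0 := by
      rw [← starRingEnd_apply] at hcc
      linear_combination h4 - ω u * inner ℂ w (ρ e (U x)) * hcc
    exact (mul_eq_zero.mp h5).resolve_left (sub_ne_zero.mpr hu)
  have hmem_of_det : ∀ e ∈ (N : Set E) * (Subgroup.centralizer (N : Set E) : Set E),
      IsDetectableBySubsystem (cliffordCode ρ N σ.character) U (ρ e) → e ∈ N := by
    rintro _ ⟨n, hn, k, hk, rfl⟩ ⟨M, hM⟩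
    have hkN : ∀ m : N, ρ k * ρ (m : E) = ρ (m : E) * ρ k := fun m => by
      rw [← map_mul, ← map_mul, Subgroup.mem_centralizer_iff.mp hk m m.2]
    have hkP : ρ k * cliffordProjector ρ N σ.character =
        cliffordProjector ρ N σ.character * ρ k := by
      rw [cliffordProjector_eq_sum]
      simp only [mul_smul_comm, smul_mul_assoc, Finset.mul_sum, Finset.sum_mul, hkN]
    have hkC : ∀ y ∈ cliffordCode ρ N σ.character, ρ k y ∈ cliffordCode ρ N σ.character := by
      rintro _ ⟨y, rfl⟩
      exact ⟨ρ k y, (LinearMap.congr_fun hkP y).symm⟩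
    -- Since `n` acts as `1 ⊗ s n`, removing it from `nk` shows that `k` acts on `C` as `1 ⊗ M'`.
    let M' := Matrix.toEuclideanLin (s ⟨n, hn⟩⁻¹) ∘ₗ M
    have hkU : ∀ x, ρ k (U x) = U (LinearMap.lTensor _ M' x) := by
      intro x
      have h1 : ρ (n * k) (U x) = U (LinearMap.lTensor _ M x) := by
        have h2 : ρ (n * k) (U x) ∈ cliffordCode ρ N σ.character := by
          obtain ⟨y, hy⟩ := U.surjective ⟨_, hkC _ (U x).2⟩
          have h3 := hU ⟨n, hn⟩ y
          rw [hy] at h3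
          rw [map_mul, Module.End.mul_apply]
          exact h3 ▸ (U _).2
        rw [← hM x]
        exact (congrArg Subtype.val
          (Submodule.orthogonalProjectionOnto_mem_subspace_eq_self ⟨_, h2⟩)).symm
      have h4 := hU ⟨n, hn⟩⁻¹ (LinearMap.lTensor _ M x)
      rw [← h1, ← Module.End.mul_apply, ← map_mul] at h4
      rw [LinearMap.lTensor_comp, LinearMap.comp_apply, ← h4]
      simp
    -- As `k` centralizes `N`, `1 ⊗ M'` commutes with every `1 ⊗ s m`; `a ≠ 0` lets the factor `A`
    -- be dropped before Schur's lemma applies.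
    obtain ⟨c, hc⟩ := hs.exists_eq_smul_id_of_commute M' (fun m => by
      apply LinearMap.lTensor_euclideanSpace_injective ha
      refine LinearMap.ext fun x => U.injective (Subtype.ext ?_)
      have h1 := LinearMap.congr_fun (hkN m) (U x : H)
      simp only [Module.End.mul_apply, hU, hkU] at h1
      simpa only [LinearMap.lTensor_comp, LinearMap.comp_apply] using h1)
    have hkc : ρ k * cliffordProjector ρ N σ.character =
        c • cliffordProjector ρ N σ.character := by
      ext y
      obtain ⟨x, hx⟩ := U.surjective ⟨_, y, rfl⟩
      have h1 := hkU x
      rw [hc, LinearMap.lTensor_smul, LinearMap.lTensor_id, LinearMap.smul_apply,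
        LinearMap.id_apply, map_smul, hx] at h1
      exact h1
    have hc0 : c ≠ 0 := by
      rintro rfl
      have h1 := LinearMap.congr_fun hkc x₀
      rw [zero_smul, LinearMap.zero_apply, Module.End.mul_apply] at h1
      have h2 := congrArg (ρ k⁻¹) h1
      rw [← Module.End.mul_apply, ← map_mul] at h2
      exact hx₀ (by simpa using h2)
    -- `tr(ρ(k)P) = c tr P ≠ 0` is a combination of the values `φ(km)`, so some `km` is central,
    -- hence in `N`.
    have h1 := trace_mul_cliffordProjector ρ N σ.character k
    rw [← Module.End.mul_eq_comp, hkc, map_smul, smul_eq_mul] at h1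
    have h2 := h1 ▸ mul_ne_zero hc0 htr
    obtain ⟨m, -, hm⟩ := Finset.exists_ne_zero_of_sum_ne_zero (right_ne_zero_of_mul h2)
    have h3 : k * m ∈ Subgroup.center E := by
      by_contra h
      exact right_ne_zero_of_mul hm (hφ _ h)
    exact N.mul_mem hn ((N.mul_mem_cancel_right m.2).mp (hZN h3))
  ext e
  simp only [Set.mem_ofPred_eq, Set.mem_sdiff, Set.mem_univ, true_and, not_and, not_not]
  refine ⟨fun h he => hmem_of_det e he h, fun h => ?_⟩
  by_cases he : e ∈ (N : Set E) * (Subgroup.centralizer (N : Set E) : Set E)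
  · exact hdet_mem e (h he)
  · exact hdet_notMem e he
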